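/- Let $\nu$ be a probability law on $\mathbb{R}$ with variance $\sigma^2>0$ whose cumulants are all finite, that is, $\mathbb{E}[e^{tX}]<\infty$ for $X\sim\nu$ and all $t$ in a neighbourhood of $0$, so that every cumulant $\kappa_m=K^{(m)}(0)$, $K(t)=\ln\mathbb{E}[e^{tX}]$, is a real number (a bound on $\kappa_m$ that is uniform in $m$ is not required). For an array $n=(n[u,v])_{0\le u<U,\,0\le v<V}$ of independent random variables of law $\nu$ let $$\mathscr{F}(n)[k,l]=\frac1{UV}\sum_{u=0}^{U-1}\sum_{v=0}^{V-1}n[u,v]\,e^{-2\pi i\left(\frac{ku}{U}+\frac{lv}{V}\right)},\qquad 0\le k<U,\ 0\le l<V,$$ and let $a(n)[k,l]$ and $b(n)[k,l]$ be its real and imaginary parts. Call these $2UV$ real random variables the Fourier coefficients of $n$. The coefficient $b(n)[k,l]$ is called degenerate if $U\mid 2k$ and $V\mid 2l$. Two coefficients are called conjugate if both are real parts or both are imaginary parts and their frequencies are equal or opposite modulo $(U,V)$. Every degenerate coefficient is identically $0$, and every other coefficient $X$ has positive variance; write $\tilde X=(X-\mathbb{E}X)/\sqrt{\operatorname{Var}X}$.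 As $UV\to\infty$ (that is, along any sequence of sizes $(U_i,V_i)$ with $U_iV_i\to\infty$, with $n_i$ an array as above of size $U_i\times V_i$, and with frequencies that may depend on $i$): (i) for every choice of a non-degenerate Fourier coefficient $X_i$ of $n_i$, $\tilde X_i$ converges in distribution to $\mathcal{N}(0,1)$; (ii) the coefficients become independent: for every fixed $d$ and every choice of $d$ non-degenerate, pairwise non-conjugate Fourier coefficients $X_{i,1},\dots,X_{i,d}$ of $n_i$, the vector $(\tilde X_{i,1},\dots,\tilde X_{i,d})$ converges in distribution to a vector of $d$ independent $\mathcal{N}(0,1)$ variables. -/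

import Mathlib

open MeasureTheory ProbabilityTheory Filter

namespace DFTNoise

/-- The normalized two-dimensional discrete Fourier transform of a real `U × V` array:
`(1 / UV) ∑ u, ∑ v, x[u,v] exp(-2πi (ku/U + lv/V))`. -/
noncomputable def dft {U V : ℕ} (x : Fin U → Fin V → ℝ) (k : Fin U) (l : Fin V) : ℂ :=
  (1 / ((U : ℂ) * (V : ℂ))) * ∑ u : Fin U, ∑ v : Fin V, (x u v : ℂ) *
    Complex.exp (-(2 * (Real.pi : ℂ) * Complex.I *
      (((k : ℕ) : ℂ) * ((u : ℕ) : ℂ) / (U : ℂ) + ((l : ℕ) : ℂ) * ((v : ℕ) : ℂ) / (V : ℂ))))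

/-- Real or imaginary part. -/
inductive Part
  | re
  | im

/-- The label of one real Fourier coefficient of a `U × V` array: the real or the imaginary part,
and the frequency `[k,l]`. -/
structure Label (U V : ℕ) where
  part : Part
  k : Fin U
  l : Fin V

namespace Label

variable {U V : ℕ}

/-- The real coefficient `a(x)[k,l]` or the imaginary coefficient `b(x)[k,l]`. -/
noncomputable def coeff (q : Label U V) (x : Fin U → Fin V → ℝ) : ℝ :=
  match q.part with
  | Part.re => (dft x q.k q.l).re
  | Part.im => (dft x q.k q.l).im

/-- The label is the imaginary part at a frequency with `[-k,-l] = [k,l]` modulo `(U,V)`. -/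
def Degenerate (q : Label U V) : Prop :=
  q.part = Part.im ∧ U ∣ 2 * (q.k : ℕ) ∧ V ∣ 2 * (q.l : ℕ)

/-- The two labels denote the same part, at frequencies that are equal or opposite modulo `(U,V)`;
for real arrays the two coefficients then agree up to sign (`F[-k,-l]` is the complex conjugate
of `F[k,l]`). -/
def Conjugate (q r : Label U V) : Prop :=
  q.part = r.part ∧
    ((q.k = r.k ∧ q.l = r.l) ∨
      (U ∣ (q.k : ℕ) + (r.k : ℕ) ∧ V ∣ (q.l : ℕ) + (r.l : ℕ)))

end Label

/-- All cumulants of the law `ν` are finite: the moment generating function is finite in a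
neighbourhood of `0`, so that the cumulant generating function `cgf id ν` is analytic there and
each cumulant, its `m`-th derivative at `0`, is a real number. The bound on the `m`-th cumulant
may depend on `m`. -/
def HasFiniteCumulants (ν : Measure ℝ) : Prop :=
  (0 : ℝ) ∈ interior (integrableExpSet id ν)

/-- `n` is noise on the `U × V` grid with independent entries of common law `ν`. -/
def IsIIDNoise {Ω : Type*} [MeasurableSpace Ω] (P : Measure Ω) (ν : Measure ℝ) {U V : ℕ}
    (n : Fin U → Fin V → Ω → ℝ) : Prop :=
  iIndepFun (fun p : Fin U × Fin V => n p.1 p.2) P ∧ ∀ u v, HasLaw (n u v) ν P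

/-- The coefficient with label `q` of the random array `n`, a random variable. -/
noncomputable def noiseCoeff {Ω : Type*} {U V : ℕ} (n : Fin U → Fin V → Ω → ℝ) (q : Label U V)
    (ω : Ω) : ℝ :=
  q.coeff (fun u v => n u v ω)

/-- `(X - E X) / σ(X)`. -/
noncomputable def standardize {Ω : Type*} [MeasurableSpace Ω] (P : Measure Ω) (X : Ω → ℝ)
    (ω : Ω) : ℝ :=
  (X ω - ∫ ω', X ω' ∂P) / Real.sqrt (variance X P)

end DFTNoise

/-!
A Fourier coefficient of the noise is a weighted sum of its independent entries, the weights being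
the real parts of a character of `ℤ/U × ℤ/V` times a unit (`1` for real parts, `-i` for imaginary
parts). By orthogonality of characters, the weight vectors of non-conjugate coefficients are
orthogonal, and a weight vector either vanishes (degenerate coefficients) or has squared norm at
least `UV / 2`. The standardized coefficients are therefore sums of standardized entries with
orthonormal weights, uniformly of size `O((UV)^{-1/2})`.

If `w p ∈ ℝ^d` collects the weights of the entry `p` and `φ` is the characteristic function of a
standardized entry, then the vector of coefficients has characteristic function `∏ p, φ ⟪w p, t⟫`.
Since `φ` agrees with the Gaussian characteristic function up to `o(x ^ 2)`, replacing it factor by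
factor costs `o(∑ p, ⟪w p, t⟫ ^ 2)`. This sum equals `‖t‖ ^ 2` by orthonormality, so the cost tends
to `0` for fixed `t`, and Lévy's continuity theorem concludes.
-/

namespace DFTNoise

open scoped Topology RealInnerProductSpace ComplexConjugate

/-! ### A central limit theorem for sums with small weights -/

lemma norm_prod_sub_prod_le_sum {R ι : Type*} [NormedCommRing R] [NormOneClass R] {s : Finset ι}
    {f g : ι → R} (hf : ∀ p ∈ s, ‖f p‖ ≤ 1) (hg : ∀ p ∈ s, ‖g p‖ ≤ 1) :
    ‖∏ p ∈ s, f p - ∏ p ∈ s, g p‖ ≤ ∑ p ∈ s, ‖f p - g p‖ := by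
  classical
  induction s using Finset.induction_on with
  | empty => simp
  | insert a s ha ih =>
    rw [Finset.forall_mem_insert] at hf hg
    rw [Finset.prod_insert ha, Finset.prod_insert ha, Finset.sum_insert ha]
    have hprod : ‖∏ p ∈ s, f p‖ ≤ 1 :=
      (Finset.norm_prod_le _ _).trans (Finset.prod_le_one (fun _ _ => norm_nonneg _) hf.2)
    calc ‖f a * ∏ p ∈ s, f p - g a * ∏ p ∈ s, g p‖
        = ‖(f a - g a) * ∏ p ∈ s, f p + g a * (∏ p ∈ s, f p - ∏ p ∈ s, g p)‖ := by ring_nf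
      _ ≤ ‖f a - g a‖ * ‖∏ p ∈ s, f p‖ + ‖g a‖ * ‖∏ p ∈ s, f p - ∏ p ∈ s, g p‖ :=
        (norm_add_le _ _).trans (add_le_add (norm_mul_le _ _) (norm_mul_le _ _))
      _ ≤ ‖f a - g a‖ * 1 + 1 * ∑ p ∈ s, ‖f p - g p‖ := by
        gcongr
        exacts [hg.1, ih hf.2 hg.2]
      _ = ‖f a - g a‖ + ∑ p ∈ s, ‖f p - g p‖ := by ring

lemma charFun_sub_charFun_isLittleO_sq {μ μ' : Measure ℝ} [IsProbabilityMeasure μ]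
    [IsProbabilityMeasure μ'] (hmean : ∫ x, x ∂μ = 0) (hvar : variance id μ = 1)
    (hmean' : ∫ x, x ∂μ' = 0) (hvar' : variance id μ' = 1) :
    (fun t => charFun μ t - charFun μ' t) =o[𝓝 0] fun t : ℝ => t ^ 2 := by
  rw [variance_of_integral_eq_zero aemeasurable_id hmean] at hvar
  rw [variance_of_integral_eq_zero aemeasurable_id hmean'] at hvar'
  have h := taylor_charFun_two (P := μ) aemeasurable_id hmean hvar
  have h' := taylor_charFun_two (P := μ') aemeasurable_id hmean' hvar'
  simp only [Measure.map_id] at h h'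
  simpa using h.sub h'

section NullArray

variable {α : Type*} {l : Filter α} {ι : α → Type*} [∀ i, Fintype (ι i)] {a : ∀ i, ι i → ℝ}
  {ε : α → ℝ} {s : ℝ}

lemma tendsto_sum_norm_of_isLittleO_sq {E : Type*} [SeminormedAddCommGroup E] {f : ℝ → E}
    (hf : f =o[𝓝 0] fun t => t ^ 2) (hε : Tendsto ε l (𝓝 0)) (ha : ∀ i p, |a i p| ≤ ε i)
    (hs : Tendsto (fun i => ∑ p, a i p ^ 2) l (𝓝 s)) :
    Tendsto (fun i => ∑ p, ‖f (a i p)‖) l (𝓝 0) := by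
  have hlittle : (fun i => ∑ p, ‖f (a i p)‖) =o[l] fun i => ∑ p, a i p ^ 2 := by
    refine Asymptotics.isLittleO_iff.2 fun c hc => ?_
    obtain ⟨r, hr, hball⟩ := Metric.eventually_nhds_iff.1 (hf.def hc)
    filter_upwards [hε.eventually_lt_const hr] with i hi
    rw [Real.norm_of_nonneg (by positivity), Real.norm_of_nonneg (by positivity), Finset.mul_sum]
    refine Finset.sum_le_sum fun p _ => ?_
    simpa using hball (y := a i p) (by simpa using (ha i p).trans_lt hi)
  exact (Asymptotics.isLittleO_one_iff ℝ).1 (hlittle.trans_isBigO (hs.isBigO_one ℝ))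

lemma tendsto_prod_charFun_sub_prod_charFun {μ μ' : Measure ℝ} [IsProbabilityMeasure μ]
    [IsProbabilityMeasure μ'] (hmean : ∫ x, x ∂μ = 0) (hvar : variance id μ = 1)
    (hmean' : ∫ x, x ∂μ' = 0) (hvar' : variance id μ' = 1) (hε : Tendsto ε l (𝓝 0))
    (ha : ∀ i p, |a i p| ≤ ε i) (hs : Tendsto (fun i => ∑ p, a i p ^ 2) l (𝓝 s)) :
    Tendsto (fun i => ∏ p, charFun μ (a i p) - ∏ p, charFun μ' (a i p)) l (𝓝 0) :=
  squeeze_zero_norm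
    (fun _ => norm_prod_sub_prod_le_sum (fun _ _ => norm_charFun_le_one _)
      fun _ _ => norm_charFun_le_one _)
    (tendsto_sum_norm_of_isLittleO_sq
      (charFun_sub_charFun_isLittleO_sq hmean hvar hmean' hvar') hε ha hs)

lemma tendsto_prod_charFun {μ : Measure ℝ} [IsProbabilityMeasure μ] (hmean : ∫ x, x ∂μ = 0)
    (hvar : variance id μ = 1) (hε : Tendsto ε l (𝓝 0)) (ha : ∀ i p, |a i p| ≤ ε i)
    (hs : Tendsto (fun i => ∑ p, a i p ^ 2) l (𝓝 s)) :
    Tendsto (fun i => ∏ p, charFun μ (a i p)) l (𝓝 (Complex.exp (-(s : ℂ) / 2))) := by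
  have hgauss (i : α) : ∏ p, charFun (gaussianReal 0 1) (a i p) =
      Complex.exp (-((∑ p, a i p ^ 2 : ℝ) : ℂ) / 2) := by
    simp [charFun_gaussianReal, ← Complex.exp_sum, Finset.sum_div, neg_div]
  have hlim : Tendsto (fun i => ∏ p, charFun (gaussianReal 0 1) (a i p)) l
      (𝓝 (Complex.exp (-(s : ℂ) / 2))) := by
    simp_rw [hgauss]
    exact ((by fun_prop : Continuous fun x : ℝ => Complex.exp (-(x : ℂ) / 2)).tendsto s).comp hs
  have hvar_gauss : variance id (gaussianReal 0 1) = 1 := by simp [variance_id_gaussianReal]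
  simpa using (tendsto_prod_charFun_sub_prod_charFun hmean hvar integral_id_gaussianReal
    hvar_gauss hε ha hs).add hlim

end NullArray

section VectorWeights

variable {E : Type*} [NormedAddCommGroup E] [InnerProductSpace ℝ E] [MeasurableSpace E]
  [BorelSpace E]

lemma charFun_map_smul_const {Ω : Type*} [MeasurableSpace Ω] {P : Measure Ω} {Y : Ω → ℝ}
    (hY : AEMeasurable Y P) (w t : E) :
    charFun (P.map fun ω => Y ω • w) t = charFun (P.map Y) ⟪w, t⟫ := by
  have hYw : AEMeasurable (fun ω => Y ω • w) P :=
    (continuous_id.smul continuous_const).measurable.comp_aemeasurable hY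
  rw [charFun_apply, charFun_apply_real, integral_map hYw (by fun_prop),
    integral_map hY (by fun_prop)]
  simp only [real_inner_smul_left, Complex.ofReal_mul, mul_comm]

variable [FiniteDimensional ℝ E]

theorem tendstoInDistribution_sum_smul {μ : Measure ℝ} [IsProbabilityMeasure μ]
    (hmean : ∫ x, x ∂μ = 0) (hvar : variance id μ = 1) {ι : ℕ → Type*} [∀ i, Fintype (ι i)]
    {Ω : ℕ → Type*} [∀ i, MeasurableSpace (Ω i)] {P : ∀ i, Measure (Ω i)}
    [∀ i, IsProbabilityMeasure (P i)] {Y : ∀ i, ι i → Ω i → ℝ} (hY : ∀ i, iIndepFun (Y i) (P i))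
    (hlaw : ∀ i p, HasLaw (Y i p) μ (P i)) {w : ∀ i, ι i → E}
    (hw : ∀ t, Tendsto (fun i => ∑ p, ⟪w i p, t⟫ ^ 2) atTop (𝓝 (‖t‖ ^ 2))) {ε : ℕ → ℝ}
    (hε : Tendsto ε atTop (𝓝 0)) (hsmall : ∀ i p, ‖w i p‖ ≤ ε i) :
    TendstoInDistribution (fun i ω => ∑ p, Y i p ω • w i p) atTop id P (stdGaussian E) := by
  have hmeas (i : ℕ) (p : ι i) : AEMeasurable (fun ω => Y i p ω • w i p) (P i) :=
    (continuous_id.smul continuous_const).measurable.comp_aemeasurable (hlaw i p).aemeasurable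
  refine ⟨fun i => Finset.aemeasurable_fun_sum _ fun p _ => hmeas i p, aemeasurable_id, ?_⟩
  refine ProbabilityMeasure.tendsto_iff_tendsto_charFun.2 fun t => ?_
  have hindep (i : ℕ) : iIndepFun (fun p ω => Y i p ω • w i p) (P i) :=
    (hY i).comp (fun p x => x • w i p) fun p => (continuous_id.smul continuous_const).measurable
  have hprod (i : ℕ) : charFun ((P i).map fun ω => ∑ p, Y i p ω • w i p) t =
      ∏ p, charFun μ ⟪w i p, t⟫ := by
    rw [(hindep i).charFun_map_fun_sum_eq_prod (hmeas i), Finset.prod_apply]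
    refine Finset.prod_congr rfl fun p _ => ?_
    rw [charFun_map_smul_const (hlaw i p).aemeasurable, (hlaw i p).map_eq]
  have hsmall_inner (i : ℕ) (p : ι i) : |⟪w i p, t⟫| ≤ ε i * ‖t‖ :=
    (abs_real_inner_le_norm _ _).trans (by gcongr; exact hsmall i p)
  simp only [ProbabilityMeasure.coe_mk, Measure.map_id, charFun_stdGaussian, hprod]
  simpa using tendsto_prod_charFun hmean hvar (by simpa using hε.mul_const ‖t‖) hsmall_inner (hw t)

end VectorWeights

lemma tendstoInDistribution_id_of_hasLaw {α Ω' E : Type*} {Ω : α → Type*}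
    [∀ i, MeasurableSpace (Ω i)] [MeasurableSpace Ω'] [TopologicalSpace E] [MeasurableSpace E]
    [OpensMeasurableSpace E] {P : ∀ i, Measure (Ω i)} [∀ i, IsProbabilityMeasure (P i)]
    {P' : Measure Ω'} [IsProbabilityMeasure P'] {ρ : Measure E} [IsProbabilityMeasure ρ]
    {X : ∀ i, Ω i → E} {l : Filter α} {Z : Ω' → E} (h : TendstoInDistribution X l Z P P')
    (hZ : HasLaw Z ρ P') : TendstoInDistribution X l id P ρ := by
  refine ⟨h.forall_aemeasurable, aemeasurable_id, ?_⟩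
  simpa only [Measure.map_id, hZ.map_eq] using h.tendsto

/-! ### Standardized sums of independent variables -/

section Standardize

variable {Ω : Type*} [MeasurableSpace Ω] {P : Measure Ω}

lemma integral_standardize [IsProbabilityMeasure P] {X : Ω → ℝ} (hX : Integrable X P) :
    ∫ ω, standardize P X ω ∂P = 0 := by
  simp only [standardize]
  rw [integral_div, integral_sub hX (integrable_const _)]
  simp

lemma variance_standardize [IsProbabilityMeasure P] {X : Ω → ℝ} (hX : AEStronglyMeasurable X P)
    (hvar : 0 < variance X P) : variance (standardize P X) P = 1 := by
  have h : standardize P X = fun ω => (√(variance X P))⁻¹ * (X ω - ∫ ω', X ω' ∂P) :=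
    funext fun _ => div_eq_inv_mul _ _
  rw [h, variance_const_mul, variance_sub_const hX, inv_pow, Real.sq_sqrt hvar.le,
    inv_mul_cancel₀ hvar.ne']

variable {ι : Type*} [Fintype ι] {ν : Measure ℝ} {Y : ι → Ω → ℝ}

lemma integral_sum_mul (hν : Integrable id ν) (hlaw : ∀ p, HasLaw (Y p) ν P) (c : ι → ℝ) :
    ∫ ω, ∑ p, c p * Y p ω ∂P = (∑ p, c p) * ∫ x, x ∂ν := by
  have hint (p : ι) : Integrable (Y p) P :=
    ((hlaw p).map_eq ▸ hν).comp_aemeasurable (hlaw p).aemeasurable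
  rw [integral_finsetSum _ fun p _ => (hint p).const_mul _, Finset.sum_mul]
  simp only [integral_const_mul, (hlaw _).integral_eq]

lemma variance_sum_mul (hν : MemLp id 2 ν) (hY : iIndepFun Y P) (hlaw : ∀ p, HasLaw (Y p) ν P)
    (c : EuclideanSpace ℝ ι) :
    variance (fun ω => ∑ p, c p * Y p ω) P = ‖c‖ ^ 2 * variance id ν := by
  have hLp (p : ι) : MemLp (fun ω => c p * Y p ω) 2 P :=
    (((hlaw p).map_eq ▸ hν).comp_of_map (hlaw p).aemeasurable).const_mul _
  have hindep : iIndepFun (fun p ω => c p * Y p ω) P :=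
    hY.comp (fun p x => c p * x) fun p => by fun_prop
  rw [← Finset.sum_fn, IndepFun.variance_sum (fun p _ => hLp p)
    fun p _ p' _ hne => hindep.indepFun hne, EuclideanSpace.real_norm_sq_eq, Finset.sum_mul]
  simp only [variance_const_mul, (hlaw _).variance_eq]

lemma standardize_sum_mul [IsProbabilityMeasure ν] (hν : MemLp id 2 ν) (hY : iIndepFun Y P)
    (hlaw : ∀ p, HasLaw (Y p) ν P) (c : EuclideanSpace ℝ ι) (ω : Ω) :
    standardize P (fun ω => ∑ p, c p * Y p ω) ω =
      ∑ p, NormedSpace.normalize c p * standardize ν id (Y p ω) := by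
  rw [standardize, integral_sum_mul (hν.integrable one_le_two) hlaw, variance_sum_mul hν hY hlaw,
    Real.sqrt_mul (sq_nonneg _), Real.sqrt_sq (norm_nonneg _), Finset.sum_mul,
    ← Finset.sum_sub_distrib, Finset.sum_div]
  refine Finset.sum_congr rfl fun p _ => ?_
  simp only [NormedSpace.normalize, PiLp.smul_apply, smul_eq_mul, standardize, id_eq]
  rw [← mul_sub, mul_div_mul_comm, ← div_eq_inv_mul]

end Standardize

section OrthogonalWeights

variable {κ : Type*} [Fintype κ]

-- The columns of a matrix with orthonormal rows form a Parseval frame.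
lemma sum_sq_inner_of_orthonormal {ι : Type*} [Fintype ι] {v : κ → EuclideanSpace ℝ ι}
    (hv : Orthonormal ℝ v) (t : EuclideanSpace ℝ κ) :
    ∑ p, ⟪WithLp.toLp 2 fun j => v j p, t⟫ ^ 2 = ‖t‖ ^ 2 := by
  have hcoord (p : ι) : ⟪WithLp.toLp 2 fun j => v j p, t⟫ = (∑ j, t j • v j) p := by
    simp [PiLp.inner_apply]
  simp_rw [hcoord]
  rw [← EuclideanSpace.real_norm_sq_eq, ← real_inner_self_eq_norm_sq, hv.inner_sum,
    EuclideanSpace.real_norm_sq_eq]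
  simp [sq]

lemma norm_toLp_two_le {x : κ → ℝ} {r : ℝ} (hx : ∀ j, |x j| ≤ r) :
    ‖WithLp.toLp 2 x‖ ≤ √(Fintype.card κ * r ^ 2) := by
  refine Real.le_sqrt_of_sq_le ?_
  rw [EuclideanSpace.real_norm_sq_eq]
  calc ∑ j, x j ^ 2 ≤ ∑ _j : κ, r ^ 2 := Finset.sum_le_sum fun j _ => sq_le_sq.2 <|
        (hx j).trans (le_abs_self r)
    _ = Fintype.card κ * r ^ 2 := by simp

theorem tendstoInDistribution_standardize_sum_mul {ν : Measure ℝ} [IsProbabilityMeasure ν]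
    (hσ : 0 < variance id ν) {ι : ℕ → Type*} [∀ i, Fintype (ι i)]
    {Ω : ℕ → Type*} [∀ i, MeasurableSpace (Ω i)] {P : ∀ i, Measure (Ω i)}
    [∀ i, IsProbabilityMeasure (P i)] {Y : ∀ i, ι i → Ω i → ℝ} (hY : ∀ i, iIndepFun (Y i) (P i))
    (hlaw : ∀ i p, HasLaw (Y i p) ν (P i)) {c : ∀ i, κ → EuclideanSpace ℝ (ι i)}
    (hc : ∀ i j, c i j ≠ 0) (horth : ∀ i, Pairwise fun j j' => ⟪c i j, c i j'⟫ = 0) {ε : ℕ → ℝ}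
    (hε : Tendsto ε atTop (𝓝 0)) (hsmall : ∀ i j p, |NormedSpace.normalize (c i j) p| ≤ ε i) :
    TendstoInDistribution
      (fun i ω j => standardize (P i) (fun ω => ∑ p, c i j p * Y i p ω) ω) atTop
      (id : (κ → ℝ) → (κ → ℝ)) P (Measure.pi fun _ : κ => gaussianReal 0 1) := by
  -- `variance` has the junk value `0` when there is no second moment.
  have hν : MemLp id 2 ν := memLp_two_of_variance_ne_zero aestronglyMeasurable_id hσ.ne'
  have hmeas : Measurable (standardize ν id) := by unfold standardize; fun_prop
  have hlaw_std : HasLaw (standardize ν id) (ν.map (standardize ν id)) ν :=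
    ⟨hmeas.aemeasurable, rfl⟩
  have : IsProbabilityMeasure (ν.map (standardize ν id)) :=
    Measure.isProbabilityMeasure_map hmeas.aemeasurable
  have hmean : ∫ x, x ∂(ν.map (standardize ν id)) = 0 := by
    rw [← hlaw_std.integral_eq, integral_standardize (hν.integrable one_le_two)]
  have hvar : variance id (ν.map (standardize ν id)) = 1 := by
    rw [← hlaw_std.variance_eq, variance_standardize aestronglyMeasurable_id hσ]
  have horthonormal (i : ℕ) : Orthonormal ℝ fun j => NormedSpace.normalize (c i j) :=
    ⟨fun j => NormedSpace.norm_normalize (hc i j), fun j j' hne => by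
      simp [NormedSpace.normalize, real_inner_smul_left, real_inner_smul_right, horth i hne]⟩
  have hvec := tendstoInDistribution_sum_smul hmean hvar
    (fun i => (hY i).comp (fun _ => standardize ν id) fun _ => hmeas)
    (fun i p => hlaw_std.comp (hlaw i p))
    (w := fun i p => WithLp.toLp 2 fun j => NormedSpace.normalize (c i j) p)
    (fun t => by simp only [sum_sq_inner_of_orthonormal (horthonormal _), tendsto_const_nhds])
    (ε := fun i => √(Fintype.card κ * ε i ^ 2))
    (by simpa using ((hε.pow 2).const_mul (Fintype.card κ : ℝ)).sqrt)
    fun i p => norm_toLp_two_le fun j => hsmall i j p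
  have hlim : HasLaw (WithLp.ofLp ∘ id) (Measure.pi fun _ : κ => gaussianReal 0 1)
      (stdGaussian (EuclideanSpace ℝ κ)) := by
    refine ⟨by fun_prop, ?_⟩
    rw [← map_pi_eq_stdGaussian, Measure.map_map (by fun_prop) (by fun_prop)]
    exact Measure.map_id
  convert tendstoInDistribution_id_of_hasLaw
    (hvec.continuous_comp (PiLp.continuous_ofLp 2 fun _ : κ => ℝ)) hlim using 4 with i ω j
  rw [standardize_sum_mul hν (hY i) (hlaw i)]
  simp [mul_comm]

end OrthogonalWeights

/-! ### Orthogonality of the Fourier weights -/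

/-- The kernel `exp (-2πi (ku/U + lv/V))` of the transform at the grid point `p = (u, v)`. The
frequencies are integers so that they can be added and negated. -/
noncomputable def kernel (U V : ℕ) (k l : ℤ) (p : Fin U × Fin V) : ℂ :=
  Complex.exp (-(2 * Real.pi * Complex.I * (k * (p.1 : ℕ) / U + l * (p.2 : ℕ) / V)))

section Kernel

variable {U V : ℕ}

lemma norm_kernel (k l : ℤ) (p : Fin U × Fin V) : ‖kernel U V k l p‖ = 1 := by
  rw [kernel, Complex.norm_exp]
  simp [Complex.div_re, Complex.div_im]

lemma kernel_add (k l k' l' : ℤ) (p : Fin U × Fin V) :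
    kernel U V (k + k') (l + l') p = kernel U V k l p * kernel U V k' l' p := by
  simp only [kernel, ← Complex.exp_add, Int.cast_add]
  ring_nf

lemma kernel_neg (k l : ℤ) (p : Fin U × Fin V) :
    kernel U V (-k) (-l) p = conj (kernel U V k l p) := by
  simp only [kernel, ← Complex.exp_conj, map_neg, map_mul, map_add, map_div₀, map_natCast,
    map_intCast, map_ofNat, Complex.conj_ofReal, Complex.conj_I, Int.cast_neg]
  ring_nf

lemma kernel_sub (k l k' l' : ℤ) (p : Fin U × Fin V) :
    kernel U V (k - k') (l - l') p = kernel U V k l p * conj (kernel U V k' l' p) := by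
  rw [sub_eq_add_neg, sub_eq_add_neg, kernel_add, kernel_neg]

lemma sum_exp_neg_two_pi_mul_div (N : ℕ) (k : ℤ) :
    ∑ u : Fin N, Complex.exp (-(2 * Real.pi * Complex.I * (k * (u : ℕ) / N))) =
      if (N : ℤ) ∣ k then (N : ℂ) else 0 := by
  rcases eq_or_ne N 0 with rfl | hN
  · simp
  have hζ := Complex.isPrimitiveRoot_exp N hN
  set ζ := Complex.exp (2 * Real.pi * Complex.I / N) with hζ_def
  have hterm (u : ℕ) :
      Complex.exp (-(2 * Real.pi * Complex.I * (k * (u : ℕ) / N))) = (ζ ^ (-k)) ^ u := by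
    rw [hζ_def, ← Complex.exp_int_mul, ← Complex.exp_nat_mul]
    push_cast
    ring_nf
  have hone : ζ ^ (-k) = 1 ↔ (N : ℤ) ∣ k := by rw [hζ.zpow_eq_one_iff_dvd, dvd_neg]
  simp_rw [hterm]
  rw [Fin.sum_univ_eq_sum_range fun u => (ζ ^ (-k)) ^ u]
  split_ifs with hk
  · simp [hone.2 hk]
  · have hpow : (ζ ^ (-k)) ^ N = 1 := by
      rw [← zpow_natCast, zpow_comm, zpow_natCast, hζ.pow_eq_one, one_zpow]
    rw [geom_sum_eq (mt hone.1 hk), hpow, sub_self, zero_div]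

lemma sum_kernel (k l : ℤ) :
    ∑ p, kernel U V k l p = if (U : ℤ) ∣ k ∧ (V : ℤ) ∣ l then (U * V : ℂ) else 0 := by
  simp only [kernel, mul_add, neg_add, Complex.exp_add, Fintype.sum_prod_type]
  rw [← Finset.sum_mul_sum, sum_exp_neg_two_pi_mul_div, sum_exp_neg_two_pi_mul_div,
    ite_zero_mul_ite_zero]

lemma dft_eq_sum_kernel (x : Fin U → Fin V → ℝ) (k : Fin U) (l : Fin V) :
    dft x k l = ((U * V : ℝ)⁻¹ : ℝ) * ∑ p : Fin U × Fin V,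
      (x p.1 p.2 : ℂ) * kernel U V (k : ℕ) (l : ℕ) p := by
  simp [dft, kernel, Fintype.sum_prod_type]

end Kernel

/-- The unit `1` or `-i` whose product with a complex number has that number's real or imaginary
part as its real part. It lets both kinds of coefficients be treated by one formula. -/
noncomputable def Part.phase : Part → ℂ
  | Part.re => 1
  | Part.im => -Complex.I

lemma Part.norm_phase (s : Part) : ‖s.phase‖ = 1 := by
  cases s <;> simp [phase]

namespace Label

variable {U V : ℕ}

lemma coeff_eq_re (q : Label U V) (x : Fin U → Fin V → ℝ) :
    q.coeff x = (q.part.phase * dft x q.k q.l).re := by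
  rcases q with ⟨_ | _, k, l⟩ <;> simp [coeff, Part.phase]

lemma degenerate_iff {q : Label U V} : q.Degenerate ↔ q.part = Part.im ∧
    (U : ℤ) ∣ ((q.k : ℕ) : ℤ) + (q.k : ℕ) ∧ (V : ℤ) ∣ ((q.l : ℕ) : ℤ) + (q.l : ℕ) := by
  simp only [Degenerate, two_mul]
  norm_cast

lemma conjugate_iff {q r : Label U V} : q.Conjugate r ↔ q.part = r.part ∧
    (((U : ℤ) ∣ ((q.k : ℕ) : ℤ) - (r.k : ℕ) ∧ (V : ℤ) ∣ ((q.l : ℕ) : ℤ) - (r.l : ℕ)) ∨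
      ((U : ℤ) ∣ ((q.k : ℕ) : ℤ) + (r.k : ℕ) ∧ (V : ℤ) ∣ ((q.l : ℕ) : ℤ) + (r.l : ℕ))) := by
  have hdvd {N : ℕ} (a b : Fin N) : (N : ℤ) ∣ ((a : ℕ) : ℤ) - (b : ℕ) ↔ a = b := by
    rw [← Int.modEq_iff_dvd, Int.natCast_modEq_iff, Nat.ModEq, Nat.mod_eq_of_lt a.2,
      Nat.mod_eq_of_lt b.2, Fin.ext_iff, eq_comm]
  rw [Conjugate, hdvd, hdvd]
  norm_cast

lemma grid_size_pos (q : Label U V) : (0 : ℝ) < U * V :=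
  mul_pos (Nat.cast_pos.2 (Fin.pos q.k)) (Nat.cast_pos.2 (Fin.pos q.l))

/-- The vector of weights with which the entries of an array enter the coefficient `q`, up to the
factor `1 / UV`. It is a Euclidean vector because the covariance of two noise coefficients is
proportional to the inner product of their weights. -/
noncomputable def weight (q : Label U V) : EuclideanSpace ℝ (Fin U × Fin V) :=
  WithLp.toLp 2 fun p => (q.part.phase * kernel U V (q.k : ℕ) (q.l : ℕ) p).re

lemma abs_weight_le_one (q : Label U V) (p : Fin U × Fin V) : |q.weight p| ≤ 1 :=
  (Complex.abs_re_le_norm _).trans_eq <| by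
    rw [norm_mul, Part.norm_phase, norm_kernel, one_mul]

lemma coeff_eq_sum (q : Label U V) (x : Fin U → Fin V → ℝ) :
    q.coeff x = ∑ p : Fin U × Fin V, ((U * V : ℝ)⁻¹ • q.weight) p * x p.1 p.2 := by
  rw [coeff_eq_re, dft_eq_sum_kernel, mul_left_comm, Complex.re_ofReal_mul, Finset.mul_sum,
    Complex.re_sum, Finset.mul_sum]
  refine Finset.sum_congr rfl fun p _ => ?_
  rw [mul_left_comm, Complex.re_ofReal_mul, PiLp.smul_apply, smul_eq_mul, weight]
  ring

lemma inner_weight (q r : Label U V) : ⟪q.weight, r.weight⟫ =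
    (q.part.phase * r.part.phase *
        ∑ p, kernel U V ((q.k : ℕ) + (r.k : ℕ)) ((q.l : ℕ) + (r.l : ℕ)) p +
      q.part.phase * conj r.part.phase *
        ∑ p, kernel U V ((q.k : ℕ) - (r.k : ℕ)) ((q.l : ℕ) - (r.l : ℕ)) p).re / 2 := by
  have hre (z w : ℂ) : z.re * w.re = (z * w + z * conj w).re / 2 := by
    simp only [Complex.add_re, Complex.mul_re, Complex.conj_re, Complex.conj_im]
    ring
  rw [PiLp.inner_apply, Finset.mul_sum, Finset.mul_sum, ← Finset.sum_add_distrib, Complex.re_sum,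
    Finset.sum_div]
  refine Finset.sum_congr rfl fun p _ => ?_
  rw [Real.inner_apply, weight, weight, hre, kernel_add, kernel_sub, map_mul]
  ring_nf

lemma inner_weight_eq_zero {q r : Label U V} (h : ¬ q.Conjugate r) :
    ⟪q.weight, r.weight⟫ = 0 := by
  rw [inner_weight, sum_kernel, sum_kernel]
  by_cases hpart : q.part = r.part
  · obtain ⟨hsub, hadd⟩ := not_or.1 fun hfreq => h (conjugate_iff.2 ⟨hpart, hfreq⟩)
    simp [if_neg hsub, if_neg hadd]
  · rcases q with ⟨_ | _, k, l⟩ <;> rcases r with ⟨_ | _, k', l'⟩ <;>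
      first
        | exact absurd rfl hpart
        | (simp only [Part.phase]; split_ifs <;> simp)

lemma norm_weight_sq (q : Label U V) : ‖q.weight‖ ^ 2 =
    ((q.part.phase ^ 2 * ∑ p, kernel U V ((q.k : ℕ) + (q.k : ℕ)) ((q.l : ℕ) + (q.l : ℕ)) p).re +
      U * V) / 2 := by
  rw [← real_inner_self_eq_norm_sq, inner_weight, Complex.mul_conj, Complex.normSq_eq_norm_sq,
    Part.norm_phase, sub_self, sub_self, sum_kernel 0 0]
  simp [sq]

lemma weight_eq_zero {q : Label U V} (h : q.Degenerate) : q.weight = 0 := by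
  obtain ⟨hpart, hfreq⟩ := degenerate_iff.1 h
  rw [← norm_eq_zero, ← sq_eq_zero_iff, norm_weight_sq, sum_kernel, if_pos hfreq, hpart]
  simp [Part.phase]

lemma half_grid_size_le_norm_weight_sq {q : Label U V} (h : ¬ q.Degenerate) :
    (U * V : ℝ) / 2 ≤ ‖q.weight‖ ^ 2 := by
  rw [norm_weight_sq, sum_kernel]
  gcongr
  rw [le_add_iff_nonneg_left]
  split_ifs with hfreq
  · have hpart : q.part = Part.re := by
      cases hq : q.part
      · rfl
      · exact absurd (degenerate_iff.2 ⟨hq, hfreq⟩) h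
    rw [hpart, Part.phase, one_pow, one_mul, ← Nat.cast_mul, Complex.natCast_re]
    positivity
  · simp

lemma weight_ne_zero {q : Label U V} (h : ¬ q.Degenerate) : q.weight ≠ 0 := by
  have hsq : 0 < ‖q.weight‖ ^ 2 :=
    (half_pos q.grid_size_pos).trans_le (half_grid_size_le_norm_weight_sq h)
  simpa using hsq.ne'

lemma abs_normalize_weight_le {q : Label U V} (h : ¬ q.Degenerate) (p : Fin U × Fin V) :
    |NormedSpace.normalize q.weight p| ≤ √(2 / (U * V)) := by
  have hpos := q.grid_size_pos
  have hsq : q.weight p ^ 2 ≤ 1 := (sq_le_one_iff_abs_le_one _).2 (q.abs_weight_le_one p)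
  refine Real.abs_le_sqrt ?_
  calc NormedSpace.normalize q.weight p ^ 2 = q.weight p ^ 2 / ‖q.weight‖ ^ 2 := by
        rw [NormedSpace.normalize, PiLp.smul_apply, smul_eq_mul, mul_pow, inv_pow, div_eq_inv_mul]
    _ ≤ 1 / ((U * V : ℝ) / 2) := by
        gcongr
        exact half_grid_size_le_norm_weight_sq h
    _ = 2 / (U * V) := one_div_div _ _

end Label

/-! ### Noise coefficients -/

section NoiseCoeff

lemma noiseCoeff_eq_sum {Ω : Type*} {U V : ℕ} (n : Fin U → Fin V → Ω → ℝ) (q : Label U V) :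
    noiseCoeff n q =
      fun ω => ∑ p : Fin U × Fin V, ((U * V : ℝ)⁻¹ • q.weight) p * n p.1 p.2 ω :=
  funext fun _ => q.coeff_eq_sum _

lemma noiseCoeff_eq_zero {Ω : Type*} {U V : ℕ} (n : Fin U → Fin V → Ω → ℝ) {q : Label U V}
    (h : q.Degenerate) (ω : Ω) : noiseCoeff n q ω = 0 := by
  simp [noiseCoeff_eq_sum, Label.weight_eq_zero h]

variable {ν : Measure ℝ} [IsProbabilityMeasure ν]

lemma variance_noiseCoeff_pos (hσ : 0 < variance id ν) {Ω : Type*} [MeasurableSpace Ω]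
    {P : Measure Ω} {U V : ℕ} {n : Fin U → Fin V → Ω → ℝ} (hn : IsIIDNoise P ν n)
    {q : Label U V} (h : ¬ q.Degenerate) : 0 < variance (noiseCoeff n q) P := by
  have hν : MemLp id 2 ν := memLp_two_of_variance_ne_zero aestronglyMeasurable_id hσ.ne'
  have hweight : (U * V : ℝ)⁻¹ • q.weight ≠ 0 :=
    smul_ne_zero (inv_ne_zero q.grid_size_pos.ne') (Label.weight_ne_zero h)
  rw [noiseCoeff_eq_sum, variance_sum_mul hν hn.1 fun p => hn.2 p.1 p.2]
  positivity

variable (hσ : 0 < variance id ν) {U V : ℕ → ℕ}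
  (hUV : Tendsto (fun i => U i * V i) atTop atTop) {Ω : ℕ → Type*} [∀ i, MeasurableSpace (Ω i)]
  {P : ∀ i, Measure (Ω i)} [∀ i, IsProbabilityMeasure (P i)]
  {n : ∀ i, Fin (U i) → Fin (V i) → Ω i → ℝ} (hn : ∀ i, IsIIDNoise (P i) ν (n i))

include hσ hUV hn

theorem tendstoInDistribution_standardize_noiseCoeff_pi {κ : Type*} [Fintype κ]
    {q : ∀ i, κ → Label (U i) (V i)} (hq : ∀ i j, ¬ (q i j).Degenerate)
    (hconj : ∀ i j j', j ≠ j' → ¬ (q i j).Conjugate (q i j')) :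
    TendstoInDistribution (fun i ω j => standardize (P i) (noiseCoeff (n i) (q i j)) ω) atTop
      (id : (κ → ℝ) → (κ → ℝ)) P (Measure.pi fun _ : κ => gaussianReal 0 1) := by
  have hpos (i : ℕ) (j : κ) : (0 : ℝ) < (U i * V i : ℝ)⁻¹ := inv_pos.2 (q i j).grid_size_pos
  have hε : Tendsto (fun i => √(2 / ((U i : ℝ) * V i))) atTop (𝓝 0) := by
    have hcast : Tendsto (fun i => (U i : ℝ) * V i) atTop atTop := by
      simpa [Function.comp_def] using (tendsto_natCast_atTop_atTop (R := ℝ)).comp hUV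
    simpa using (hcast.const_div_atTop 2).sqrt
  simp only [noiseCoeff_eq_sum]
  refine tendstoInDistribution_standardize_sum_mul hσ (fun i => (hn i).1)
    (fun i p => (hn i).2 p.1 p.2) (fun i j => ?_) (fun i j j' hne => ?_) hε fun i j p => ?_
  · exact smul_ne_zero (hpos i j).ne' (Label.weight_ne_zero (hq i j))
  · simp [real_inner_smul_left, real_inner_smul_right,
      Label.inner_weight_eq_zero (hconj i j j' hne)]
  · rw [NormedSpace.normalize_smul_of_pos (hpos i j)]
    exact Label.abs_normalize_weight_le (hq i j) p

theorem tendstoInDistribution_standardize_noiseCoeff {q : ∀ i, Label (U i) (V i)}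
    (hq : ∀ i, ¬ (q i).Degenerate) :
    TendstoInDistribution (fun i => standardize (P i) (noiseCoeff (n i) (q i))) atTop
      (id : ℝ → ℝ) P (gaussianReal 0 1) := by
  have hpi := tendstoInDistribution_standardize_noiseCoeff_pi hσ hUV hn
    (q := fun i (_ : Unit) => q i) (fun i _ => hq i) fun _ _ _ hne => absurd rfl hne
  exact tendstoInDistribution_id_of_hasLaw (hpi.continuous_comp (continuous_apply ()))
    (measurePreserving_eval (fun _ : Unit => gaussianReal 0 1) ()).hasLaw

end NoiseCoeff

end DFTNoise

theorem theorem1_general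
    (ν : Measure ℝ) [IsProbabilityMeasure ν]
    (hσ : 0 < variance id ν)
    (U V : ℕ → ℕ) (hUV : Tendsto (fun i => U i * V i) atTop atTop)
    {Ω : ℕ → Type*} [∀ i, MeasurableSpace (Ω i)]
    (P : ∀ i, Measure (Ω i)) [∀ i, IsProbabilityMeasure (P i)]
    (n : ∀ i, Fin (U i) → Fin (V i) → Ω i → ℝ)
    (hn : ∀ i, DFTNoise.IsIIDNoise (P i) ν (n i)) :
    (∀ i (q : DFTNoise.Label (U i) (V i)), q.Degenerate →
      ∀ ω, DFTNoise.noiseCoeff (n i) q ω = 0) ∧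
    (∀ i (q : DFTNoise.Label (U i) (V i)), ¬ q.Degenerate →
      0 < variance (DFTNoise.noiseCoeff (n i) q) (P i)) ∧
    (∀ q : ∀ i, DFTNoise.Label (U i) (V i), (∀ i, ¬ (q i).Degenerate) →
      TendstoInDistribution
        (fun i => DFTNoise.standardize (P i) (DFTNoise.noiseCoeff (n i) (q i)))
        atTop (id : ℝ → ℝ) P (gaussianReal 0 1)) ∧
    (∀ (d : ℕ) (q : ∀ i, Fin d → DFTNoise.Label (U i) (V i)),
      (∀ i j, ¬ (q i j).Degenerate) →
      (∀ i j j', j ≠ j' → ¬ (q i j).Conjugate (q i j')) →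
      TendstoInDistribution
        (fun i ω j => DFTNoise.standardize (P i) (DFTNoise.noiseCoeff (n i) (q i j)) ω)
        atTop (id : (Fin d → ℝ) → (Fin d → ℝ)) P
        (Measure.pi fun _ : Fin d => gaussianReal 0 1)) :=
  ⟨fun i _ => DFTNoise.noiseCoeff_eq_zero (n i),
    fun i _ => DFTNoise.variance_noiseCoeff_pos hσ (hn i),
    fun _ => DFTNoise.tendstoInDistribution_standardize_noiseCoeff hσ hUV hn,
    fun _ _ => DFTNoise.tendstoInDistribution_standardize_noiseCoeff_pi hσ hUV hn⟩

theorem theorem1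
    (ν : Measure ℝ) [IsProbabilityMeasure ν]
    (hν : DFTNoise.HasFiniteCumulants ν) (hσ : 0 < variance id ν)
    (U V : ℕ → ℕ) (hUV : Tendsto (fun i => U i * V i) atTop atTop)
    {Ω : ℕ → Type*} [∀ i, MeasurableSpace (Ω i)]
    (P : ∀ i, Measure (Ω i)) [∀ i, IsProbabilityMeasure (P i)]
    (n : ∀ i, Fin (U i) → Fin (V i) → Ω i → ℝ)
    (hn : ∀ i, DFTNoise.IsIIDNoise (P i) ν (n i)) :
    -- degenerate coefficients vanish identically; all others have positive variance
    (∀ i (q : DFTNoise.Label (U i) (V i)), q.Degenerate →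
      ∀ ω, DFTNoise.noiseCoeff (n i) q ω = 0) ∧
    (∀ i (q : DFTNoise.Label (U i) (V i)), ¬ q.Degenerate →
      0 < variance (DFTNoise.noiseCoeff (n i) q) (P i)) ∧
    -- (i) each standardized coefficient converges in distribution to a standard Gaussian
    (∀ q : ∀ i, DFTNoise.Label (U i) (V i), (∀ i, ¬ (q i).Degenerate) →
      TendstoInDistribution
        (fun i => DFTNoise.standardize (P i) (DFTNoise.noiseCoeff (n i) (q i)))
        atTop (id : ℝ → ℝ) P (gaussianReal 0 1)) ∧
    -- (ii) finitely many coefficients, no two of them conjugate, are asymptotically independent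
    (∀ (d : ℕ) (q : ∀ i, Fin d → DFTNoise.Label (U i) (V i)),
      (∀ i j, ¬ (q i j).Degenerate) →
      (∀ i j j', j ≠ j' → ¬ (q i j).Conjugate (q i j')) →
      TendstoInDistribution
        (fun i ω j => DFTNoise.standardize (P i) (DFTNoise.noiseCoeff (n i) (q i j)) ω)
        atTop (id : (Fin d → ℝ) → (Fin d → ℝ)) P
        (Measure.pi fun _ : Fin d => gaussianReal 0 1)) := by
  exact theorem1_general ν hσ U V hUV P n hn
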